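/- Let $n\in\{1,2,3,\dots\}$ and $d\in\{1,\dots,n\}$, and let $M_1,\dots,M_d\subseteq\{1,\dots,n\}$ be pairwise disjoint non-empty sets with $\bigcup_{k=1}^d M_k=\{1,\dots,n\}$; put $m_k=|M_k|$. Let $Z=(z_{j,r})\in\mathbb{C}^{n\times n}$, and let $\operatorname{per}(Z)=\sum_{\sigma}\prod_{j=1}^n z_{j,\sigma(j)}$ be its permanent, where $\sigma$ runs over all permutations of $\{1,\dots,n\}$. For each $k\in\{1,\dots,d\}$ let $s_k\in M_k$ be fixed, and assume that $|z_{j,r}|=|z_{j,s_k}|$ for all $j\in\{1,\dots,n\}$, $k\in\{1,\dots,d\}$ and $r\in M_k$. Then $$|\operatorname{per}(Z)|\;\le\; n!\prod_{k=1}^d\Bigl(\frac{1}{\binom{n}{m_k}}\sum_{\substack{I\subseteq\{1,\dots,n\}\\ |I|=m_k}}\ \prod_{j\in I}|z_{j,s_k}|^2\Bigr)^{1/2}.$$ Moreover, this bound is at least as good as the Hadamard type bound of Carlen, Lieb and Loss for permanents: $$n!\prod_{k=1}^d\Bigl(\frac{1}{\binom{n}{m_k}}\sum_{\substack{I\subseteq\{1,\dots,n\}\\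 |I|=m_k}}\ \prod_{j\in I}|z_{j,s_k}|^2\Bigr)^{1/2}\;\le\; n!\prod_{r=1}^n\Bigl(\frac1n\sum_{j=1}^n|z_{j,r}|^2\Bigr)^{1/2}.$$ -/

import Mathlib

open scoped Nat

/-! ### Averaging over transpositions -/

section Symmetrization

open scoped Pointwise
open Finset

variable {ι α : Type*} [DecidableEq α]

/-! The triangle inequality bounds the permanent by `permSum M F`, with `F k I` the product over `j
∈ I` of `|z_{j,s_k}|²`. Averaging all `F k` over a transposition keeps their sums over m-sets and
does not decrease `permSum` (`permSum_le_involutionAverage`). A function that no such averaging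
changes is constant on m-sets, and there the bound is an equality; compactness supplies one
(`permSum_le`). The comparison with the Carlen–Lieb–Loss bound is Maclaurin's inequality applied to
each block. -/

theorem swap_smul_finset_of_notMem {x y : α} {J : Finset α} (hx : x ∉ J) (hy : y ∉ J) :
    Equiv.swap x y • J = J := by
  have h : ∀ j ∈ J, Equiv.swap x y • j = j := fun j hj =>
    Equiv.swap_apply_of_ne_of_ne (fun h => hx (h ▸ hj)) (fun h => hy (h ▸ hj))
  ext i
  rw [Finset.mem_smul_finset]
  constructor
  · rintro ⟨j, hj, rfl⟩
    rwa [h j hj]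
  · intro hi
    exact ⟨i, hi, h i hi⟩

theorem exists_perm_smul_finset_eq {I J : Finset α} (h : I.card = J.card) :
    ∃ σ : Equiv.Perm α, σ • J = I := by
  have hI : I ∈ Set.powersetCard α J.card := h
  have hJ : J ∈ Set.powersetCard α J.card := rfl
  have := Set.powersetCard.isPretransitive (α := α) (n := J.card)
  obtain ⟨σ, hσ⟩ := MulAction.exists_smul_eq (Equiv.Perm α) (⟨J, hJ⟩ : Set.powersetCard α J.card)
    (⟨I, hI⟩ : Set.powersetCard α J.card)
  refine ⟨σ, ?_⟩
  have := congrArg (fun t : Set.powersetCard α J.card => (t : Finset α)) hσ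
  simpa using this

/-- If two nonnegative families have at most two entries, then the sum of the products of the
square roots is at most twice the product of the square roots of the averages. -/
theorem prod_sqrt_add_prod_sqrt_le_of_card_le_two (S : Finset ι) (hS : S.card ≤ 2)
    (a b : ι → ℝ) (ha : ∀ k, 0 ≤ a k) (hb : ∀ k, 0 ≤ b k) :
    ∏ k ∈ S, √(a k) + ∏ k ∈ S, √(b k) ≤ 2 * ∏ k ∈ S, √((a k + b k) / 2) := by
  classical
  have h3 : S.card = 0 ∨ S.card = 1 ∨ S.card = 2 := by omega
  rcases h3 with h | h | h
  · rw [Finset.card_eq_zero] at h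
    subst h
    norm_num
  · obtain ⟨p, rfl⟩ := Finset.card_eq_one.1 h
    simp only [Finset.prod_singleton]
    have h1 := Real.sq_sqrt (ha p)
    have h2 := Real.sq_sqrt (hb p)
    have h4 : (√(a p) + √(b p)) / 2 ≤ √((a p + b p) / 2) := by
      apply Real.le_sqrt_of_sq_le
      nlinarith [sq_nonneg (√(a p) - √(b p))]
    linarith
  · obtain ⟨p, q, hpq, rfl⟩ := Finset.card_eq_two.1 h
    rw [Finset.prod_pair hpq, Finset.prod_pair hpq, Finset.prod_pair hpq]
    rw [← Real.sqrt_mul (by linarith [ha p, hb p] : 0 ≤ (a p + b p) / 2)]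
    have h1 := Real.sq_sqrt (ha p)
    have h2 := Real.sq_sqrt (hb p)
    have h3 := Real.sq_sqrt (ha q)
    have h4 := Real.sq_sqrt (hb q)
    -- Cauchy–Schwarz for the vectors `(√(a p), √(b p))` and `(√(a q), √(b q))`; this is why two
    -- entries are the limit.
    have h5 : (√(a p) * √(a q) + √(b p) * √(b q)) / 2
        ≤ √((a p + b p) / 2 * ((a q + b q) / 2)) := by
      apply Real.le_sqrt_of_sq_le
      rw [← h1, ← h2, ← h3, ← h4]
      simp only [Real.sqrt_sq (Real.sqrt_nonneg _)]
      nlinarith [sq_nonneg (√(a p) * √(b q) - √(b p) * √(a q))]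
    linarith

variable [Fintype ι] [Fintype α]

theorem prod_sqrt_add_prod_sqrt_le (S : Finset ι) (hS : S.card ≤ 2)
    (a b : ι → ℝ) (ha : ∀ k, 0 ≤ a k) (hb : ∀ k, 0 ≤ b k) (hab : ∀ k, k ∉ S → a k = b k) :
    ∏ k, √(a k) + ∏ k, √(b k) ≤ 2 * ∏ k, √((a k + b k) / 2) := by
  classical
  have h1 := prod_sqrt_add_prod_sqrt_le_of_card_le_two S hS a b ha hb
  rw [← Finset.prod_mul_prod_compl S (fun k => √(a k)),
    ← Finset.prod_mul_prod_compl S (fun k => √(b k)),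
    ← Finset.prod_mul_prod_compl S (fun k => √((a k + b k) / 2))]
  have h2 : ∏ k ∈ Sᶜ, √(b k) = ∏ k ∈ Sᶜ, √(a k) :=
    Finset.prod_congr rfl fun k hk => by rw [hab k (Finset.mem_compl.1 hk)]
  have h3 : ∏ k ∈ Sᶜ, √((a k + b k) / 2) = ∏ k ∈ Sᶜ, √(a k) :=
    Finset.prod_congr rfl fun k hk => by
      rw [← hab k (Finset.mem_compl.1 hk), add_self_div_two]
  rw [h2, h3, ← add_mul, ← mul_assoc]
  exact mul_le_mul_of_nonneg_right h1 (Finset.prod_nonneg fun _ _ => Real.sqrt_nonneg _)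

/-- The average of a set function over the group generated by an involution. -/
noncomputable def involutionAverage (τ : Equiv.Perm α) (F : ι → Finset α → ℝ) :
    ι → Finset α → ℝ :=
  fun k I => (F k I + F k (τ • I)) / 2

/-- The sum over all permutations of the product of the square roots of set functions, evaluated
at the images of given sets. -/
noncomputable def permSum (M : ι → Finset α) (F : ι → Finset α → ℝ) : ℝ :=
  ∑ σ : Equiv.Perm α, ∏ k, √(F k (σ • M k))

/-- Pair `σ` with `τ * σ`. The transposition can change `σ • M k` only if this set contains `x` or
`y`; by disjointness this happens for at most two `k`, so Cauchy–Schwarz applies to each pair. -/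
theorem permSum_le_involutionAverage (M : ι → Finset α)
    (hM : ∀ k l, k ≠ l → Disjoint (M k) (M l))
    (F : ι → Finset α → ℝ) (hF : ∀ k I, 0 ≤ F k I) (x y : α) :
    permSum M F ≤ permSum M (involutionAverage (Equiv.swap x y) F) := by
  classical
  set τ := Equiv.swap x y with hτ
  have h1 : ∑ σ : Equiv.Perm α, ∏ k, √(F k ((τ * σ) • M k)) = permSum M F :=
    Equiv.sum_comp (Equiv.mulLeft τ) (fun σ : Equiv.Perm α => ∏ k, √(F k (σ • M k)))
  have h2 : permSum M F + ∑ σ : Equiv.Perm α, ∏ k, √(F k ((τ * σ) • M k))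
      ≤ 2 * permSum M (involutionAverage τ F) := by
    unfold permSum
    rw [← Finset.sum_add_distrib, Finset.mul_sum]
    refine Finset.sum_le_sum fun σ _ => ?_
    have huniq : ∀ z : α, (univ.filter fun k => z ∈ σ • M k).card ≤ 1 := by
      intro z
      rw [Finset.card_le_one]
      intro k hk l hl
      by_contra hkl
      simp only [Finset.mem_filter, Finset.mem_univ, true_and] at hk hl
      rw [← Finset.inv_smul_mem_iff] at hk hl
      exact Finset.disjoint_left.1 (hM k l hkl) hk hl
    refine prod_sqrt_add_prod_sqrt_le
      ((univ.filter fun k => x ∈ σ • M k) ∪ (univ.filter fun k => y ∈ σ • M k))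
      ((Finset.card_union_le _ _).trans (by linarith [huniq x, huniq y]))
      (fun k => F k (σ • M k)) (fun k => F k ((τ * σ) • M k)) (fun k => hF _ _)
      (fun k => hF _ _) ?_ |>.trans_eq ?_
    · intro k hk
      simp only [Finset.mem_union, Finset.mem_filter, Finset.mem_univ, true_and, not_or] at hk
      simp only [mul_smul]
      rw [hτ, swap_smul_finset_of_notMem hk.1 hk.2]
    · simp only [involutionAverage, mul_smul]
  linarith

theorem sum_smul_powersetCard (τ : Equiv.Perm α) (m : ℕ) (f : Finset α → ℝ) :
    ∑ I ∈ powersetCard m univ, f (τ • I) = ∑ I ∈ powersetCard m univ, f I := by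
  refine Finset.sum_bij' (fun I _ => τ • I) (fun I _ => τ⁻¹ • I) ?_ ?_ ?_ ?_ ?_
  · intro I hI
    simpa [Finset.mem_powersetCard] using hI
  · intro I hI
    simpa [Finset.mem_powersetCard] using hI
  · intro I _
    simp
  · intro I _
    simp
  · intro I _
    rfl

theorem sum_smul_finset (τ : Equiv.Perm α) (f : Finset α → ℝ) :
    ∑ I, f (τ • I) = ∑ I, f I :=
  Equiv.sum_comp (MulAction.toPerm τ) f

theorem apply_smul_eq_of_swap {f : Finset α → ℝ}
    (h : ∀ x y : α, ∀ I, f (Equiv.swap x y • I) = f I) (σ : Equiv.Perm α) (I : Finset α) :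
    f (σ • I) = f I := by
  induction σ using Equiv.Perm.swap_induction_on generalizing I with
  | one => simp
  | swap_mul σ x y _ ih => rw [mul_smul, h, ih]

/-- Transpositions generate the symmetric group, which is transitive on sets of a given size. So
each `F k` is constant on them and equals its mean. -/
theorem permSum_eq_of_swap (M : ι → Finset α) (F : ι → Finset α → ℝ)
    (h : ∀ k, ∀ x y : α, ∀ I, F k (Equiv.swap x y • I) = F k I) :
    permSum M F = ((Fintype.card α).factorial : ℝ) *
      ∏ k, √(1 / ((Fintype.card α).choose (M k).card : ℝ) *
        ∑ I ∈ powersetCard (M k).card univ, F k I) := by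
  have h1 : ∀ k, 1 / ((Fintype.card α).choose (M k).card : ℝ) *
        ∑ I ∈ powersetCard (M k).card univ, F k I = F k (M k) := by
    intro k
    have h2 : ∀ I ∈ powersetCard (M k).card (univ : Finset α), F k I = F k (M k) := by
      intro I hI
      obtain ⟨σ, rfl⟩ := exists_perm_smul_finset_eq (Finset.mem_powersetCard.1 hI).2
      exact apply_smul_eq_of_swap (h k) σ _
    have h3 : 0 < (Fintype.card α).choose (M k).card :=
      Nat.choose_pos (Finset.card_le_univ _)
    rw [Finset.sum_congr rfl h2, Finset.sum_const, Finset.card_powersetCard, Finset.card_univ,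
      nsmul_eq_mul]
    field_simp
  simp only [h1, permSum, apply_smul_eq_of_swap (h _)]
  rw [Finset.sum_const, Finset.card_univ, Fintype.card_perm, nsmul_eq_mul]

theorem continuous_permSum (M : ι → Finset α) : Continuous (permSum M) := by
  unfold permSum
  fun_prop

/-- A sharp Hölder type inequality on the symmetric group: for functions of the images of disjoint
sets under a random permutation, the mean of the product is at most the product of the `L²`
norms. -/
theorem permSum_le (M : ι → Finset α) (hM : ∀ k l, k ≠ l → Disjoint (M k) (M l))
    (F : ι → Finset α → ℝ) (hF : ∀ k I, 0 ≤ F k I) :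
    permSum M F ≤ ((Fintype.card α).factorial : ℝ) *
      ∏ k, √(1 / ((Fintype.card α).choose (M k).card : ℝ) *
        ∑ I ∈ powersetCard (M k).card univ, F k I) := by
  classical
  set B : ℝ := ∑ k, ∑ I, F k I with hB
  have hFB : ∀ k I, F k I ≤ B := fun k I =>
    (Finset.single_le_sum (f := fun J => F k J) (fun J _ => hF k J) (mem_univ I)).trans
      (Finset.single_le_sum (f := fun l => ∑ J, F l J)
        (fun l _ => Finset.sum_nonneg fun J _ => hF l J) (mem_univ k))
  -- `K` is stable under every transposition average; the box bound `B` serves only to make it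
  -- compact.
  let K : Set (ι → Finset α → ℝ) := Set.Icc (fun _ _ => 0) (fun _ _ => B) ∩
    ({G | ∀ k, ∑ I ∈ powersetCard (M k).card univ, G k I
        = ∑ I ∈ powersetCard (M k).card univ, F k I} ∩ {G | permSum M F ≤ permSum M G})
  have hK : IsCompact K := by
    refine isCompact_Icc.inter_right (IsClosed.inter ?_ ?_)
    · rw [Set.ofPred_forall]
      exact isClosed_iInter fun k => isClosed_eq (by fun_prop) continuous_const
    · exact isClosed_le continuous_const (continuous_permSum M)
  have hFK : F ∈ K := ⟨⟨fun k I => hF k I, fun k I => hFB k I⟩, fun _ => rfl, le_refl (permSum M F)⟩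
  obtain ⟨G, ⟨⟨hG0, hGB⟩, hGsum, hGperm⟩, hmin⟩ := hK.exists_isMinOn ⟨F, hFK⟩
    (f := fun G : ι → Finset α → ℝ => ∑ k, ∑ I, G k I ^ 2) (by fun_prop)
  have hinv : ∀ k, ∀ x y : α, ∀ I, G k (Equiv.swap x y • I) = G k I := by
    intro k x y I
    set τ := Equiv.swap x y with hτ
    have hA : involutionAverage τ G ∈ K := by
      refine ⟨⟨fun l J => ?_, fun l J => ?_⟩, fun l => ?_, ?_⟩
      · have h1 := hG0 l J
        have h2 := hG0 l (τ • J)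
        simp only [involutionAverage] at *
        linarith
      · have h1 := hGB l J
        have h2 := hGB l (τ • J)
        simp only [involutionAverage] at *
        linarith
      · simp only [involutionAverage]
        rw [← Finset.sum_div, Finset.sum_add_distrib, sum_smul_powersetCard, add_self_div_two]
        exact hGsum l
      · exact le_trans hGperm (permSum_le_involutionAverage M hM G (fun l J => hG0 l J) x y)
    have hle : ∑ l, ∑ J, G l J ^ 2 ≤ ∑ l, ∑ J, involutionAverage τ G l J ^ 2 := hmin hA
    -- Parallelogram law: averaging strictly lowers the sum of squares unless `G` is `τ`-invariant,
    -- so the minimizer is invariant.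
    have hid : ∑ l, ∑ J, (G l (τ • J) - G l J) ^ 2
        = 4 * (∑ l, ∑ J, G l J ^ 2 - ∑ l, ∑ J, involutionAverage τ G l J ^ 2) := by
      rw [← Finset.sum_sub_distrib, Finset.mul_sum]
      refine Finset.sum_congr rfl fun l _ => ?_
      have h1 := sum_smul_finset τ (fun J => G l J ^ 2)
      have h2 : ∑ J, (G l (τ • J) - G l J) ^ 2 + 4 * ∑ J, involutionAverage τ G l J ^ 2
          = 2 * ∑ J, G l (τ • J) ^ 2 + 2 * ∑ J, G l J ^ 2 := by
        simp only [Finset.mul_sum, ← Finset.sum_add_distrib, involutionAverage]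
        exact Finset.sum_congr rfl fun J _ => by ring
      linarith
    have h0 : ∑ l, ∑ J, (G l (τ • J) - G l J) ^ 2 ≤ 0 := by rw [hid]; linarith
    have h1 : (G k (τ • I) - G k I) ^ 2 ≤ ∑ l, ∑ J, (G l (τ • J) - G l J) ^ 2 :=
      (Finset.single_le_sum (f := fun J => (G k (τ • J) - G k J) ^ 2)
        (fun J _ => sq_nonneg _) (mem_univ I)).trans
      (Finset.single_le_sum (f := fun l => ∑ J, (G l (τ • J) - G l J) ^ 2)
        (fun l _ => Finset.sum_nonneg fun J _ => sq_nonneg _) (mem_univ k))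
    have h2 : (G k (τ • I) - G k I) ^ 2 = 0 := le_antisymm (h1.trans h0) (sq_nonneg _)
    exact sub_eq_zero.1 (pow_eq_zero_iff two_ne_zero |>.1 h2)
  calc permSum M F ≤ permSum M G := hGperm
    _ = _ := permSum_eq_of_swap M G hinv
    _ = _ := by simp only [hGsum _]

end Symmetrization

/-! ### Maclaurin's inequality -/

section Maclaurin

open Finset

variable {α : Type*} [Fintype α] [DecidableEq α]

/-- Double counting of pointed sets: `(I, i)` corresponds to `(I.erase i, i)`. -/
theorem sum_powersetCard_succ_sum_mem (m : ℕ) (g : Finset α → α → ℝ) :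
    ∑ I ∈ powersetCard (m + 1) univ, ∑ i ∈ I, g I i
      = ∑ A ∈ powersetCard m univ, ∑ i ∈ Aᶜ, g (insert i A) i := by
  rw [Finset.sum_sigma', Finset.sum_sigma']
  refine Finset.sum_bij' (fun p _ => ⟨p.1.erase p.2, p.2⟩) (fun p _ => ⟨insert p.2 p.1, p.2⟩)
    ?_ ?_ ?_ ?_ ?_
  · rintro ⟨I, i⟩ h
    simp only [mem_sigma, mem_powersetCard, subset_univ, true_and, mem_compl] at h ⊢
    exact ⟨by rw [card_erase_of_mem h.2, h.1]; rfl, notMem_erase _ _⟩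
  · rintro ⟨A, i⟩ h
    simp only [mem_sigma, mem_powersetCard, subset_univ, true_and, mem_compl] at h ⊢
    exact ⟨by rw [card_insert_of_notMem h.2, h.1], mem_insert_self _ _⟩
  · rintro ⟨I, i⟩ h
    simp only [mem_sigma] at h
    simp [insert_erase h.2]
  · rintro ⟨A, i⟩ h
    simp only [mem_sigma, mem_compl] at h
    simp [erase_insert h.2]
  · rintro ⟨I, i⟩ h
    simp only [mem_sigma] at h
    simp [insert_erase h.2]

theorem succ_mul_sum_powersetCard_succ (m : ℕ) (y : α → ℝ) :
    (m + 1 : ℝ) * ∑ I ∈ powersetCard (m + 1) univ, ∏ j ∈ I, y j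
      = ∑ A ∈ powersetCard m univ, (∏ j ∈ A, y j) * ∑ i ∈ Aᶜ, y i := by
  have h := sum_powersetCard_succ_sum_mem m (fun I (_ : α) => ∏ j ∈ I, y j)
  rw [Finset.mul_sum]
  refine Eq.trans (Finset.sum_congr rfl fun I hI => ?_) (h.trans (Finset.sum_congr rfl fun A _ => ?_))
  · rw [Finset.sum_const, (mem_powersetCard.1 hI).2, nsmul_eq_mul]
    push_cast
    rfl
  · rw [Finset.mul_sum]
    refine Finset.sum_congr rfl fun i hi => ?_
    rw [prod_insert (mem_compl.1 hi), mul_comm]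

/-- One step of Maclaurin's chain. Expanding over sets `A` with one element fewer than `m` reduces
it to Cauchy–Schwarz for `y` on `Aᶜ`; no such `A` exists for `m = 0`, where equality holds. -/
theorem card_mul_succ_mul_sum_powersetCard_succ_le (m : ℕ) (y : α → ℝ) (hy : ∀ j, 0 ≤ y j)
    (hm : m + 1 ≤ Fintype.card α) :
    (Fintype.card α : ℝ) * ((m + 1 : ℝ) * ∑ I ∈ powersetCard (m + 1) univ, ∏ j ∈ I, y j)
      ≤ (Fintype.card α - m : ℝ) * ((∑ j, y j) * ∑ I ∈ powersetCard m univ, ∏ j ∈ I, y j) := by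
  rcases m with _ | m
  · have h := succ_mul_sum_powersetCard_succ 0 y
    simp at h ⊢
    rw [h]
  set n : ℝ := (Fintype.card α : ℝ) with hn
  set e := (((m + 1 : ℕ) : ℝ) + 1) * ∑ I ∈ powersetCard (m + 1 + 1) univ, ∏ j ∈ I, y j with he
  set p := ∑ I ∈ powersetCard (m + 1) univ, ∑ i ∈ I, (∏ j ∈ I, y j) * y i with hp
  have h1 : (∑ j, y j) * ∑ I ∈ powersetCard (m + 1) univ, ∏ j ∈ I, y j = e + p := by
    rw [he, succ_mul_sum_powersetCard_succ, hp, ← Finset.sum_add_distrib, Finset.mul_sum]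
    refine Finset.sum_congr rfl fun I _ => ?_
    rw [← Finset.mul_sum, ← mul_add, add_comm, Finset.sum_add_sum_compl, mul_comm]
  have h2 : p = ∑ A ∈ powersetCard m univ, (∏ j ∈ A, y j) * ∑ i ∈ Aᶜ, y i ^ 2 := by
    rw [hp, sum_powersetCard_succ_sum_mem m (fun I i => (∏ j ∈ I, y j) * y i)]
    refine Finset.sum_congr rfl fun A _ => ?_
    rw [Finset.mul_sum]
    refine Finset.sum_congr rfl fun i hi => ?_
    rw [prod_insert (mem_compl.1 hi)]
    ring
  have h3 : (m + 1 : ℝ) * e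
      = ∑ A ∈ powersetCard m univ, (∏ j ∈ A, y j) * ((∑ i ∈ Aᶜ, y i) ^ 2 - ∑ i ∈ Aᶜ, y i ^ 2) := by
    have h4 : (m + 1 : ℝ) * e = ∑ I ∈ powersetCard (m + 1) univ, ∑ _i ∈ I,
        (∏ j ∈ I, y j) * ∑ l ∈ Iᶜ, y l := by
      rw [he, succ_mul_sum_powersetCard_succ, Finset.mul_sum]
      refine Finset.sum_congr rfl fun I hI => ?_
      rw [Finset.sum_const, (mem_powersetCard.1 hI).2, nsmul_eq_mul]
      push_cast
      rfl
    rw [h4, sum_powersetCard_succ_sum_mem m (fun I _ => (∏ j ∈ I, y j) * ∑ l ∈ Iᶜ, y l)]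
    refine Finset.sum_congr rfl fun A _ => ?_
    rw [sq, Finset.sum_mul, ← Finset.sum_sub_distrib, Finset.mul_sum]
    refine Finset.sum_congr rfl fun i hi => ?_
    rw [prod_insert (mem_compl.1 hi), compl_insert, ← Finset.add_sum_erase _ _ hi]
    ring
  have h5 : (m + 1 : ℝ) * e ≤ (n - (m + 1)) * p := by
    rw [h3, h2, Finset.mul_sum]
    refine Finset.sum_le_sum fun A hA => ?_
    have hc : (∑ i ∈ Aᶜ, y i) ^ 2 ≤ (n - m) * ∑ i ∈ Aᶜ, y i ^ 2 := by
      have := sq_sum_le_card_mul_sum_sq (s := Aᶜ) (f := y)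
      rwa [card_compl, (mem_powersetCard.1 hA).2, Nat.cast_sub (by omega)] at this
    have hpos : 0 ≤ ∏ j ∈ A, y j := Finset.prod_nonneg fun j _ => hy j
    calc _ ≤ (∏ j ∈ A, y j) * ((n - (m + 1)) * ∑ i ∈ Aᶜ, y i ^ 2) :=
          mul_le_mul_of_nonneg_left (by linarith) hpos
      _ = _ := by ring
  rw [h1]
  push_cast
  linarith

/-- Maclaurin's inequality between an elementary symmetric mean and the arithmetic mean. -/
theorem elementarySymmetricMean_le_pow (m : ℕ) (y : α → ℝ) (hy : ∀ j, 0 ≤ y j)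
    (hm : m ≤ Fintype.card α) :
    1 / ((Fintype.card α).choose m : ℝ) * ∑ I ∈ powersetCard m univ, ∏ j ∈ I, y j
      ≤ (1 / (Fintype.card α : ℝ) * ∑ j, y j) ^ m := by
  induction m with
  | zero => simp
  | succ m ih =>
    have ih := ih (by omega)
    have hstep := card_mul_succ_mul_sum_powersetCard_succ_le m y hy hm
    have hn : (0 : ℝ) < Fintype.card α := by exact_mod_cast (by omega : 0 < Fintype.card α)
    have hnm : (0 : ℝ) < Fintype.card α - m := by
      have : ((m + 1 : ℕ) : ℝ) ≤ Fintype.card α := by exact_mod_cast hm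
      push_cast at this
      linarith
    have hc : (0 : ℝ) < (Fintype.card α).choose m := by
      exact_mod_cast Nat.choose_pos (by omega : m ≤ Fintype.card α)
    have hc' : (0 : ℝ) < (Fintype.card α).choose (m + 1) := by
      exact_mod_cast Nat.choose_pos hm
    have hcc : ((Fintype.card α).choose (m + 1) : ℝ) * (m + 1)
        = (Fintype.card α).choose m * (Fintype.card α - m) := by
      have := Nat.choose_succ_right_eq (Fintype.card α) m
      rw [← Nat.cast_sub (by omega : m ≤ Fintype.card α)]
      exact_mod_cast this
    have hmul := mul_le_mul_of_nonneg_right ih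
      (mul_nonneg (one_div_nonneg.2 hn.le) (Finset.sum_nonneg fun j (_ : j ∈ univ) => hy j))
    rw [← pow_succ] at hmul
    refine le_trans ?_ hmul
    generalize (∑ I ∈ powersetCard (m + 1) univ, ∏ j ∈ I, y j) = E at *
    generalize (∑ I ∈ powersetCard m univ, ∏ j ∈ I, y j) = e at *
    generalize (∑ j, y j) = s at *
    generalize ((Fintype.card α).choose (m + 1) : ℝ) = c' at *
    generalize ((Fintype.card α).choose m : ℝ) = c at *
    generalize (Fintype.card α : ℝ) = n at *
    have hm1 : (0 : ℝ) < m + 1 := by positivity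
    have e1 : 1 / c' * E = (n * ((m + 1) * E)) / (n * (c' * (m + 1))) := by field_simp
    have e2 : 1 / c * e * (1 / n * s) = ((n - m) * (s * e)) / (n * (c * (n - m))) := by
      field_simp
    rw [e1, e2, hcc]
    exact div_le_div_of_nonneg_right hstep (by positivity)

end Maclaurin

/-! ### Application to the permanent -/

theorem mainTheorem6 (n d : ℕ) (hn : 1 ≤ n) (hd : d ∈ Finset.Icc 1 n)
    (M : Fin d → Finset (Fin n))
    (hdisj : ∀ k l : Fin d, k ≠ l → Disjoint (M k) (M l))
    (hunion : Finset.univ.biUnion M = Finset.univ)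
    (hne : ∀ k, (M k).Nonempty)
    (Z : Matrix (Fin n) (Fin n) ℂ)
    (s : Fin d → Fin n) (hs : ∀ k, s k ∈ M k)
    (hZ : ∀ j : Fin n, ∀ k : Fin d, ∀ r ∈ M k, ‖Z j r‖ = ‖Z j (s k)‖) :
    ‖Z.permanent‖ ≤
        (n ! : ℝ) * ∏ k : Fin d, √(1 / (n.choose (M k).card : ℝ) *
          ∑ I ∈ Finset.powersetCard (M k).card (Finset.univ : Finset (Fin n)),
            ∏ j ∈ I, ‖Z j (s k)‖ ^ 2) ∧
    (n ! : ℝ) * ∏ k : Fin d, √(1 / (n.choose (M k).card : ℝ) *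
          ∑ I ∈ Finset.powersetCard (M k).card (Finset.univ : Finset (Fin n)),
            ∏ j ∈ I, ‖Z j (s k)‖ ^ 2) ≤
        (n ! : ℝ) * ∏ r : Fin n, √(1 / (n : ℝ) * ∑ j : Fin n, ‖Z j r‖ ^ 2) := by
  have hprod : ∀ f : Fin n → ℝ, ∏ r, f r = ∏ k, ∏ r ∈ M k, f r := by
    intro f
    rw [← hunion, Finset.prod_biUnion fun k _ l _ hkl => hdisj k l hkl]
  constructor
  · have h1 := permSum_le M hdisj (fun k I => ∏ j ∈ I, ‖Z j (s k)‖ ^ 2)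
      (fun k I => Finset.prod_nonneg fun j _ => sq_nonneg _)
    rw [Fintype.card_fin] at h1
    refine le_trans ?_ h1
    unfold Matrix.permanent permSum
    refine (norm_sum_le _ _).trans (Finset.sum_le_sum fun σ _ => le_of_eq ?_)
    rw [norm_prod, hprod]
    refine Finset.prod_congr rfl fun k _ => ?_
    -- Within a block, column `r` may be replaced by column `s k` in absolute value, so the factor
    -- depends only on the image set `σ • M k`.
    change _ = √(∏ j ∈ (M k).image σ, ‖Z j (s k)‖ ^ 2)
    rw [Finset.prod_pow, Real.sqrt_sq (Finset.prod_nonneg fun _ _ => norm_nonneg _),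
      Finset.prod_image fun a _ b _ h => σ.injective h]
    exact Finset.prod_congr rfl fun r hr => hZ (σ r) k r hr
  · refine mul_le_mul_of_nonneg_left ?_ (Nat.cast_nonneg _)
    rw [hprod]
    refine Finset.prod_le_prod (fun _ _ => Real.sqrt_nonneg _) fun k _ => ?_
    have h1 := elementarySymmetricMean_le_pow (M k).card (fun j => ‖Z j (s k)‖ ^ 2)
      (fun j => sq_nonneg _) (Finset.card_le_univ _)
    rw [Fintype.card_fin] at h1
    have h2 : ∀ r ∈ M k, √(1 / (n : ℝ) * ∑ j : Fin n, ‖Z j r‖ ^ 2)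
        = √(1 / (n : ℝ) * ∑ j : Fin n, ‖Z j (s k)‖ ^ 2) := fun r hr => by
      simp only [hZ _ k r hr]
    rw [Finset.prod_congr rfl h2, Finset.prod_const]
    refine Real.sqrt_le_iff.2 ⟨pow_nonneg (Real.sqrt_nonneg _) _, h1.trans_eq ?_⟩
    have h3 : 0 ≤ 1 / (n : ℝ) * ∑ j : Fin n, ‖Z j (s k)‖ ^ 2 := by positivity
    rw [← pow_mul, mul_comm (M k).card, pow_mul, Real.sq_sqrt h3]
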